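/- Let $\Gamma$ be a metrized graph with a finite non-empty vertex set $V(\Gamma)$ of $v$ elements; that is, $\Gamma$ is a finite connected graph, possibly with multiple edges and self-loops, in which every edge $e$ is a closed segment of length $L_e>0$ joining its end points $a_e,b_e\in V(\Gamma)$. View $\Gamma$ as an electric circuit in which each edge has resistance equal to its length. Let $j_z(x,y)$ be the voltage difference between $x$ and $z$ when unit current enters at $y$ and exits at $z$, let $r(x,y)=j_y(x,x)$ be the effective resistance, and let $$Kf(\Gamma)=\frac12\sum_{p,q\in V(\Gamma)}r(p,q)$$ be the Kirchhoff index. For an edge $e$, let $\Gamma-e$ be the graph obtained by deleting the interior of $e$. If $\Gamma-e$ is connected, let $\hat\jmath$ be its voltage function, let $R_e$ be the effective resistance between $a_e$ and $b_e$ in $\Gamma-e$, and for $p\in V(\Gamma)$ put $R_{a_e,p}=\hat\jmath_{a_e}(p,b_e)$ and $R_{b_e,p}=\hat\jmath_{b_e}(p,a_e)$. If $\Gamma-e$ is not connected, put $(R_{a_e,p},R_{b_e,p})=(0,R_e)$ when $p$ lies in the component of $\Gamma-e$ containing $a_e$ and $(R_{a_e,p},R_{b_e,p})=(R_e,0)$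 otherwise, and replace every expression involving $R_e$ by its limit as $R_e\to\infty$. For $p\in V(\Gamma)$ let $$y(\Gamma)=\frac14\sum_{e}\frac{L_eR_e^2}{(L_e+R_e)^2}+\frac34\sum_{e}\frac{L_e(R_{a_e,p}-R_{b_e,p})^2}{(L_e+R_e)^2},$$ where the sums run over all edges of $\Gamma$ (the value is known not to depend on $p$). Then, for every such $\Gamma$ (with no assumption of regularity or bridgelessness) and for $y(\Gamma)$ computed with any vertex $p$, $$Kf(\Gamma)\le\frac{v^2}{4}\,y(\Gamma).$$ -/

import Mathlib

open Filter Topology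

/-- A finite or infinite multigraph with vertex set `V` and edge set `E`, possibly with multiple
edges and self-loops, in which each edge `e` is a closed segment of length `len e > 0` which is
parametrized from its end point `src e` to its end point `tgt e`. -/
structure LengthGraph (V E : Type*) where
  src : E → V
  tgt : E → V
  len : E → ℝ
  len_pos : ∀ e, 0 < len e

namespace LengthGraph

variable {V E : Type*}

/-- Two distinct vertices are adjacent if they are the end points of an edge. This records
exactly which vertices are joined by paths. -/
def skeleton (G : LengthGraph V E) : SimpleGraph V :=
  SimpleGraph.fromRel fun x y => ∃ e, G.src e = x ∧ G.tgt e = y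

/-- The graph `Γ - e`, obtained by deleting the interior of the edge `e`. -/
def deleteEdge (G : LengthGraph V E) (e : E) : LengthGraph V {e' : E // e' ≠ e} where
  src e' := G.src e'
  tgt e' := G.tgt e'
  len e' := G.len e'
  len_pos e' := G.len_pos e'

/-- The total current that flows from the vertex `x` into the edges at `x`, when `f` is the
potential on the vertices and the resistance of each edge is its length. -/
noncomputable def currentOut [Fintype E] [DecidableEq V] (G : LengthGraph V E) (f : V → ℝ)
    (x : V) : ℝ :=
  ∑ e, ((if G.src e = x then (f x - f (G.tgt e)) / G.len e else 0) +
    (if G.tgt e = x then (f x - f (G.src e)) / G.len e else 0))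

/-- `f` is the potential on the vertices when unit current enters at `y` and exits at `z`, with
reference voltage `0` at `z`. -/
def IsVoltage [Fintype E] [DecidableEq V] (G : LengthGraph V E) (z y : V) (f : V → ℝ) : Prop :=
  f z = 0 ∧ ∀ x, G.currentOut f x = (if x = y then 1 else 0) - (if x = z then 1 else 0)

end LengthGraph

/-- A metrized graph together with a vertex set: a connected graph with vertex set `V`
and edge set `E` (both finite wherever this is used), possibly with multiple edges and self-loops,
with a parametrization of each edge by a segment of positive length. -/
structure MetrizedGraph (V E : Type*) extends LengthGraph V E where
  connected : toLengthGraph.skeleton.Connected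

namespace MetrizedGraph

variable {V E : Type*}

section Existence

variable [Fintype V] [Fintype E] [DecidableEq V]

theorem sum_mul_currentOut (G : LengthGraph V E) (f g : V → ℝ) :
    ∑ x, g x * G.currentOut f x =
      ∑ e, (g (G.src e) - g (G.tgt e)) * (f (G.src e) - f (G.tgt e)) / G.len e := by
  simp only [LengthGraph.currentOut, Finset.mul_sum]
  rw [Finset.sum_comm]
  refine Finset.sum_congr rfl fun e _ => ?_
  simp only [mul_add, mul_ite, mul_zero, Finset.sum_add_distrib, Finset.sum_ite_eq,
    Finset.mem_univ, if_true]
  ring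

theorem eq_zero_of_currentOut (G : MetrizedGraph V E) (z : V) (f : V → ℝ) (hz : f z = 0)
    (hf : ∀ x, x ≠ z → G.currentOut f x = 0) : f = 0 := by
  have h0 : ∑ e, (f (G.src e) - f (G.tgt e)) * (f (G.src e) - f (G.tgt e)) / G.len e = 0 := by
    rw [← sum_mul_currentOut]
    refine Finset.sum_eq_zero fun x _ => ?_
    by_cases hx : x = z
    · rw [hx, hz, zero_mul]
    · rw [hf x hx, mul_zero]
  rw [Finset.sum_eq_zero_iff_of_nonneg
    (fun e _ => div_nonneg (mul_self_nonneg _) (G.len_pos e).le)] at h0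
  have he : ∀ e, f (G.src e) = f (G.tgt e) := by
    intro e
    have h1 := h0 e (Finset.mem_univ e)
    rw [div_eq_zero_iff, or_iff_left (G.len_pos e).ne', mul_self_eq_zero, sub_eq_zero] at h1
    exact h1
  have hadj : ∀ x y, G.skeleton.Adj x y → f x = f y := by
    intro x y h
    rw [LengthGraph.skeleton, SimpleGraph.fromRel_adj] at h
    rcases h.2 with ⟨e, rfl, rfl⟩ | ⟨e, rfl, rfl⟩
    · exact he e
    · exact (he e).symm
  funext x
  obtain ⟨w⟩ := G.connected.preconnected x z
  have hw : ∀ {a b : V}, G.skeleton.Walk a b → f a = f b := by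
    intro a b w
    induction w with
    | nil => rfl
    | cons h _ ih => exact (hadj _ _ h).trans ih
  rw [hw w, hz, Pi.zero_apply]

theorem existsUnique_isVoltage (G : MetrizedGraph V E) (z y : V) :
    ∃! f : V → ℝ, G.IsVoltage z y f := by
  let T : (V → ℝ) →ₗ[ℝ] (V → ℝ) :=
    { toFun := fun f x => if x = z then f z else G.currentOut f x
      map_add' := by
        intro f g
        funext x
        by_cases hx : x = z
        · simp [hx]
        · simp only [hx, if_false, Pi.add_apply, LengthGraph.currentOut,
            ← Finset.sum_add_distrib]
          refine Finset.sum_congr rfl fun e _ => ?_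
          split_ifs <;> ring
      map_smul' := by
        intro c f
        funext x
        by_cases hx : x = z
        · simp [hx]
        · simp only [hx, if_false, Pi.smul_apply, smul_eq_mul, RingHom.id_apply,
            LengthGraph.currentOut, Finset.mul_sum]
          refine Finset.sum_congr rfl fun e _ => ?_
          split_ifs <;> ring }
  have hT : ∀ f x, T f x = if x = z then f z else G.currentOut f x := fun _ _ => rfl
  have hinj : Function.Injective T := by
    rw [← LinearMap.ker_eq_bot, LinearMap.ker_eq_bot']
    intro f hf
    refine eq_zero_of_currentOut G z f ?_ fun x hx => ?_
    · simpa [hT] using congrFun hf z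
    · simpa [hT, hx] using congrFun hf x
  obtain ⟨f, hf⟩ := LinearMap.injective_iff_surjective.mp hinj
    (fun x => if x = z then 0 else if x = y then 1 else 0)
  have hz : f z = 0 := by simpa [hT] using congrFun hf z
  have hx : ∀ x, x ≠ z → G.currentOut f x = if x = y then 1 else 0 := by
    intro x hx
    simpa [hT, hx] using congrFun hf x
  have hs : ∑ x, G.currentOut f x = 0 := by
    simpa using sum_mul_currentOut G.toLengthGraph f (fun _ => 1)
  refine ⟨f, ⟨hz, fun x => ?_⟩, ?_⟩
  · by_cases h : x = z
    · subst h
      have h2 : ∑ w ∈ Finset.univ.erase x, G.currentOut f w =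
          ∑ w ∈ Finset.univ.erase x, if w = y then (1 : ℝ) else 0 :=
        Finset.sum_congr rfl fun w hw => hx w (Finset.ne_of_mem_erase hw)
      have h3 := Finset.add_sum_erase Finset.univ (G.currentOut f) (Finset.mem_univ x)
      have h4 := Finset.add_sum_erase Finset.univ (fun w => if w = y then (1 : ℝ) else 0)
        (Finset.mem_univ x)
      rw [Finset.sum_ite_eq' Finset.univ y, if_pos (Finset.mem_univ y)] at h4
      simp only [if_true]
      linarith
    · rw [hx x h, if_neg h, sub_zero]
  · rintro g ⟨hgz, hg⟩
    refine hinj ?_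
    rw [hf]
    funext x
    rw [hT]
    by_cases h : x = z
    · simp [h, hgz]
    · simp [h, hg x]

end Existence

section Invariants

variable [Fintype V] [Fintype E] [DecidableEq V]

/-- The voltage function `j_z(x, y)` on vertices: the voltage difference between `x` and `z` when
unit current enters at `y` and exits at `z`. -/
noncomputable def voltage (G : MetrizedGraph V E) (z x y : V) : ℝ :=
  (G.existsUnique_isVoltage z y).choose x

/-- The effective resistance `r(x, y) = j_y(x, x)`. -/
noncomputable def resistance (G : MetrizedGraph V E) (x y : V) : ℝ :=
  G.voltage y x x

/-- The Kirchhoff index, half the sum of `r(p, q)` over all ordered pairs of vertices. -/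
noncomputable def kirchhoffIndex (G : MetrizedGraph V E) : ℝ :=
  (1 / 2) * ∑ p, ∑ q, G.resistance p q

/-- `e` is a bridge if `Γ - e` is not connected. -/
def IsBridge (G : MetrizedGraph V E) (e : E) : Prop :=
  ¬ (G.deleteEdge e).skeleton.Connected

/-- The metrized graph `Γ - e` when `e` is not a bridge. -/
def delete (G : MetrizedGraph V E) (e : E) (he : ¬ G.IsBridge e) :
    MetrizedGraph V {e' : E // e' ≠ e} where
  toLengthGraph := G.deleteEdge e
  connected := not_not.mp he

variable [DecidableEq E]

/-- `R_e`, the resistance in `Γ - e` between the end points of `e`. -/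
noncomputable def edgeR (G : MetrizedGraph V E) (e : E) (he : ¬ G.IsBridge e) : ℝ :=
  (G.delete e he).resistance (G.src e) (G.tgt e)

/-- `R_{a,p}`, the value `j_a(p, b)` of the voltage function of `Γ - e`, where `e` has end points
`a = src e` and `b = tgt e`. -/
noncomputable def edgeRa (G : MetrizedGraph V E) (e : E) (he : ¬ G.IsBridge e) (p : V) : ℝ :=
  (G.delete e he).voltage (G.src e) p (G.tgt e)

/-- `R_{b,p}`, the value `j_b(p, a)` of the voltage function of `Γ - e`, where `e` has end points
`a = src e` and `b = tgt e`. -/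
noncomputable def edgeRb (G : MetrizedGraph V E) (e : E) (he : ¬ G.IsBridge e) (p : V) : ℝ :=
  (G.delete e he).voltage (G.tgt e) p (G.src e)

open Classical in
/-- For a bridge `e` and a value `R` assigned to `R_e`: `R_{a,p}` is `0` if `p` lies in the
component of `src e` in `Γ - e`, and `R` otherwise. -/
noncomputable def bridgeRa (G : MetrizedGraph V E) (e : E) (p : V) (R : ℝ) : ℝ :=
  if (G.deleteEdge e).skeleton.Reachable (G.src e) p then 0 else R

open Classical in
/-- For a bridge `e` and a value `R` assigned to `R_e`: `R_{b,p}` is `R` if `p` lies in the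
component of `src e` in `Γ - e`, and `0` otherwise. -/
noncomputable def bridgeRb (G : MetrizedGraph V E) (e : E) (p : V) (R : ℝ) : ℝ :=
  if (G.deleteEdge e).skeleton.Reachable (G.src e) p then R else 0

open Classical in
/-- `L R² / (L + R)²` for the edge `e`, with the limit `R → ∞` if `e` is a bridge. -/
noncomputable def sqTerm (G : MetrizedGraph V E) (e : E) : ℝ :=
  if he : G.IsBridge e then
    limUnder atTop fun R : ℝ => G.len e * R ^ 2 / (G.len e + R) ^ 2
  else G.len e * G.edgeR e he ^ 2 / (G.len e + G.edgeR e he) ^ 2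

open Classical in
/-- `L (R_{a,p} - R_{b,p})² / (L + R)²` for the edge `e`, with the limit `R → ∞` if `e` is a
bridge. -/
noncomputable def diffTerm (G : MetrizedGraph V E) (e : E) (p : V) : ℝ :=
  if he : G.IsBridge e then
    limUnder atTop fun R : ℝ =>
      G.len e * (G.bridgeRa e p R - G.bridgeRb e p R) ^ 2 / (G.len e + R) ^ 2
  else G.len e * (G.edgeRa e he p - G.edgeRb e he p) ^ 2 / (G.len e + G.edgeR e he) ^ 2

/-- The invariant `y(Γ)`, computed with respect to the vertex `p`. -/
noncomputable def yInv (G : MetrizedGraph V E) (p : V) : ℝ :=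
  (1 / 4) * ∑ e, G.sqTerm e + (3 / 4) * ∑ e, G.diffTerm e p

theorem tendsto_bridge (L : ℝ) :
    Tendsto (fun R : ℝ => L * R ^ 2 / (L + R) ^ 2) atTop (𝓝 L) := by
  have h1 : Tendsto (fun R : ℝ => L * (1 - L * (L + R)⁻¹) ^ 2) atTop (𝓝 (L * (1 - L * 0) ^ 2)) :=
    (((tendsto_inv_atTop_zero.comp (tendsto_atTop_add_const_left _ L tendsto_id)).const_mul
      L).const_sub 1).pow 2 |>.const_mul L
  simp only [mul_zero, sub_zero, one_pow, mul_one] at h1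
  refine h1.congr' ?_
  filter_upwards [eventually_gt_atTop (-L)] with R hR
  have : L + R ≠ 0 := by linarith
  field_simp
  ring

/-- The limits for bridges exist; a bridge contributes its length. -/
theorem sqTerm_of_isBridge (G : MetrizedGraph V E) (e : E) (he : G.IsBridge e) :
    G.sqTerm e = G.len e := by
  rw [sqTerm, dif_pos he]
  exact (tendsto_bridge _).limUnder_eq

theorem diffTerm_of_isBridge (G : MetrizedGraph V E) (e : E) (he : G.IsBridge e) (p : V) :
    G.diffTerm e p = G.len e := by
  rw [diffTerm, dif_pos he]
  refine Tendsto.limUnder_eq ((tendsto_bridge (G.len e)).congr fun R => ?_)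
  rw [bridgeRa, bridgeRb]
  split_ifs <;> simp

end Invariants

end MetrizedGraph

/-! Both sums in `y(Γ)`, over all edges, dominate `4 Kf / v ^ 2` on their own, and `y(Γ)` is a
convex combination of them. Let `J = j_z` be the symmetric voltage matrix with reference `z`; then
`Kf = v * tr J - ∑ J`. The deleted graphs disappear: with `a`, `b` the ends of `e`, the first
summand is `r(a, b) ^ 2 / L` (`sqTerm_eq`) and the second is `(d a - d b) ^ 2 / L` with `d x =
j_p(x, x)` (`diffTerm_eq`). First sum: `J` is a Gram matrix for the energy, so `Kf` splits over
edges into variances of potentials of unit flows from `a` to `b`. By the maximum principle each has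
range `r(a, b)`, and Popoviciu's inequality applies. Second sum: it is the energy of `d`. With `u`
the row sums of `J` for `z = p`, expanding the nonnegative energy of `v d - 2 u` gives the bound. -/

namespace LengthGraph

variable {V E : Type*}

/-! ### Energy, currents and edge deletion -/

theorem reachable_src_tgt (G : LengthGraph V E) (e : E) :
    G.skeleton.Reachable (G.src e) (G.tgt e) := by
  by_cases h : G.src e = G.tgt e
  · rw [h]
  refine SimpleGraph.Adj.reachable ?_
  rw [skeleton, SimpleGraph.fromRel_adj]
  exact ⟨h, Or.inl ⟨e, rfl, rfl⟩⟩

variable [Fintype E]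

/-- The Dirichlet form of the circuit. -/
noncomputable def energy (G : LengthGraph V E) (f g : V → ℝ) : ℝ :=
  ∑ e, (f (G.src e) - f (G.tgt e)) * (g (G.src e) - g (G.tgt e)) / G.len e

theorem energy_self_nonneg (G : LengthGraph V E) (f : V → ℝ) : 0 ≤ G.energy f f :=
  Finset.sum_nonneg fun e _ => div_nonneg (mul_self_nonneg _) (G.len_pos e).le

variable [DecidableEq V]

theorem currentOut_sub (G : LengthGraph V E) (f g : V → ℝ) (x : V) :
    G.currentOut (fun y => f y - g y) x = G.currentOut f x - G.currentOut g x := by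
  simp only [currentOut, ← Finset.sum_sub_distrib]
  refine Finset.sum_congr rfl fun e _ => ?_
  split_ifs <;> ring

theorem currentOut_const_sub (G : LengthGraph V E) (c : ℝ) (f : V → ℝ) (x : V) :
    G.currentOut (fun y => c - f y) x = -G.currentOut f x := by
  simp only [currentOut, ← Finset.sum_neg_distrib]
  refine Finset.sum_congr rfl fun e _ => ?_
  split_ifs <;> ring

theorem currentOut_sub_const (G : LengthGraph V E) (f : V → ℝ) (c : ℝ) (x : V) :
    G.currentOut (fun y => f y - c) x = G.currentOut f x := by
  simp only [currentOut, sub_sub_sub_cancel_right]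

theorem currentOut_const_mul (G : LengthGraph V E) (c : ℝ) (f : V → ℝ) (x : V) :
    G.currentOut (fun y => c * f y) x = c * G.currentOut f x := by
  simp only [currentOut, Finset.mul_sum]
  refine Finset.sum_congr rfl fun e _ => ?_
  split_ifs <;> ring

theorem currentOut_eq_zero_of_edges_eq (G : LengthGraph V E) (f : V → ℝ)
    (h : ∀ e, f (G.src e) = f (G.tgt e)) (x : V) : G.currentOut f x = 0 := by
  refine Finset.sum_eq_zero fun e _ => ?_
  have he := h e
  split_ifs with h1 h2 h2
  · rw [← h1, he]; ring
  · rw [← h1, he]; ring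
  · rw [← h2, he]; ring
  · ring

/-- Transfers potentials from `Γ - e` to `Γ`. A self-loop contributes nothing on either side. -/
theorem currentOut_eq_deleteEdge [DecidableEq E] (G : LengthGraph V E) (e : E) (f : V → ℝ)
    (x : V) :
    G.currentOut f x = (G.deleteEdge e).currentOut f x +
      (f (G.tgt e) - f (G.src e)) / G.len e *
        ((if x = G.tgt e then 1 else 0) - (if x = G.src e then 1 else 0)) := by
  simp only [currentOut]
  rw [← Finset.add_sum_erase Finset.univ _ (Finset.mem_univ e), add_comm,
    Finset.sum_subtype (Finset.univ.erase e) (p := fun e' => e' ≠ e) (by simp)]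
  congr 1
  simp only [eq_comm (a := x)]
  split_ifs with h1 h2 h2
  · rw [h1, h2]; ring
  · rw [← h1]; ring
  · rw [← h2]; ring
  · ring

end LengthGraph

namespace MetrizedGraph

section Connectivity

variable {V E : Type*}

/-- Otherwise every use of `e` in a walk could be rerouted inside `Γ - e`, which would then be
connected. -/
theorem not_reachable_of_isBridge (G : MetrizedGraph V E) {e : E} (he : G.IsBridge e) :
    ¬ (G.deleteEdge e).skeleton.Reachable (G.src e) (G.tgt e) := by
  intro h
  have hedge : ∀ e', (G.deleteEdge e).skeleton.Reachable (G.src e') (G.tgt e') := by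
    intro e'
    by_cases hee : e' = e
    · rwa [hee]
    exact (G.deleteEdge e).reachable_src_tgt ⟨e', hee⟩
  have hwalk : ∀ {x y : V}, G.skeleton.Walk x y → (G.deleteEdge e).skeleton.Reachable x y := by
    intro x y w
    induction w with
    | nil => rfl
    | cons hadj _ ih =>
      rw [LengthGraph.skeleton, SimpleGraph.fromRel_adj] at hadj
      rcases hadj.2 with ⟨e', rfl, rfl⟩ | ⟨e', rfl, rfl⟩
      · exact (hedge e').trans ih
      · exact (hedge e').symm.trans ih
  have := G.connected.nonempty
  exact he ⟨fun x y => (G.connected.preconnected x y).elim hwalk⟩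

end Connectivity

/-! ### Potentials of unit flows and the maximum principle -/

variable {V E : Type*} [Fintype V] [Fintype E] [DecidableEq V]

theorem eq_of_edges_eq (G : MetrizedGraph V E) (f : V → ℝ)
    (h : ∀ e, f (G.src e) = f (G.tgt e)) (x y : V) : f x = f y := by
  have h0 := G.eq_zero_of_currentOut y (fun x => f x - f y) (sub_self _) fun x _ =>
    G.currentOut_eq_zero_of_edges_eq _ (fun e => by rw [h e]) x
  exact sub_eq_zero.mp (congrFun h0 x)

/-- Summation by parts; this is the reproducing property behind all later identities. -/
theorem energy_eq_of_currentOut (G : MetrizedGraph V E) {a b : V} {f : V → ℝ}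
    (hf : ∀ x, G.currentOut f x = (if x = a then 1 else 0) - (if x = b then 1 else 0))
    (g : V → ℝ) : G.energy g f = g a - g b := by
  rw [LengthGraph.energy, ← sum_mul_currentOut]
  simp [hf, mul_sub]

/-- The potential of a unit flow from `a` to `b` is largest at `a`. -/
theorem le_of_currentOut (G : MetrizedGraph V E) {a b : V} {f : V → ℝ}
    (hf : ∀ x, G.currentOut f x = (if x = a then 1 else 0) - (if x = b then 1 else 0))
    (x : V) : f x ≤ f a := by
  -- Truncation shrinks differences without reversing them, so `E(φ, φ) ≤ E(φ, f) = φ a - φ b ≤ 0`.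
  -- Hence `φ` is constant, equal to `φ a = 0`.
  set φ : V → ℝ := fun x => max (f x - f a) 0 with hφ
  have h1 := G.energy_eq_of_currentOut hf φ
  have hle : ∀ e, (φ (G.src e) - φ (G.tgt e)) * (φ (G.src e) - φ (G.tgt e)) / G.len e ≤
      (φ (G.src e) - φ (G.tgt e)) * (f (G.src e) - f (G.tgt e)) / G.len e := by
    intro e
    refine div_le_div_of_nonneg_right ?_ (G.len_pos e).le
    simp only [hφ]
    rcases le_total (f (G.src e) - f a) 0 with h | h <;>
      rcases le_total (f (G.tgt e) - f a) 0 with h' | h' <;>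
      simp only [h, h', max_eq_left, max_eq_right] <;> nlinarith
  have hφa : φ a = 0 := by simp [hφ]
  have hφb : 0 ≤ φ b := le_max_right _ _
  have h2 : G.energy φ φ ≤ G.energy φ f := Finset.sum_le_sum fun e _ => hle e
  have h3 : G.energy φ φ = 0 :=
    le_antisymm (by linarith) (G.energy_self_nonneg φ)
  rw [LengthGraph.energy, Finset.sum_eq_zero_iff_of_nonneg
    (fun e _ => div_nonneg (mul_self_nonneg _) (G.len_pos e).le)] at h3
  have h4 := G.eq_of_edges_eq φ (fun e => by
    have h := h3 e (Finset.mem_univ e)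
    rwa [div_eq_zero_iff, or_iff_left (G.len_pos e).ne', mul_self_eq_zero, sub_eq_zero] at h) x a
  rw [hφa] at h4
  have h5 : f x - f a ≤ φ x := le_max_left _ _
  linarith

theorem ge_of_currentOut (G : MetrizedGraph V E) {a b : V} {f : V → ℝ}
    (hf : ∀ x, G.currentOut f x = (if x = a then 1 else 0) - (if x = b then 1 else 0))
    (x : V) : f b ≤ f x := by
  have h := G.le_of_currentOut (a := b) (b := a) (f := fun y => 0 - f y) (fun y => by
    rw [LengthGraph.currentOut_const_sub, hf, neg_sub]) x
  linarith

/-! ### The voltage function and effective resistance -/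

theorem voltage_spec (G : MetrizedGraph V E) (z y : V) :
    G.IsVoltage z y (fun x => G.voltage z x y) :=
  (G.existsUnique_isVoltage z y).choose_spec.1

theorem voltage_eq_of_isVoltage (G : MetrizedGraph V E) {z y : V} {f : V → ℝ}
    (hf : G.IsVoltage z y f) (x : V) : G.voltage z x y = f x :=
  congrFun ((G.existsUnique_isVoltage z y).unique (G.voltage_spec z y) hf) x

theorem energy_voltage (G : MetrizedGraph V E) (z y : V) (f : V → ℝ) :
    G.energy f (fun x => G.voltage z x y) = f y - f z :=
  G.energy_eq_of_currentOut (G.voltage_spec z y).2 f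

/-- Reciprocity: both sides are the mutual energy of `j_z(·, x)` and `j_z(·, y)`. -/
theorem voltage_symm (G : MetrizedGraph V E) (z x y : V) : G.voltage z x y = G.voltage z y x := by
  have h1 := G.energy_voltage z y (fun w => G.voltage z w x)
  have h2 := G.energy_voltage z x (fun w => G.voltage z w y)
  simp only [(G.voltage_spec z _).1, sub_zero] at h1 h2
  rw [← h1, ← h2, LengthGraph.energy, LengthGraph.energy]
  simp only [mul_comm]

theorem currentOut_voltage_sub (G : MetrizedGraph V E) (z a b x : V) :
    G.currentOut (fun y => G.voltage z y a - G.voltage z y b) x =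
      (if x = a then 1 else 0) - (if x = b then 1 else 0) := by
  rw [LengthGraph.currentOut_sub, (G.voltage_spec z a).2, (G.voltage_spec z b).2]
  ring

/-- As functions of `x`, both sides carry the same currents and vanish at `z`. -/
theorem voltage_sub_eq (G : MetrizedGraph V E) {a b : V} {f : V → ℝ}
    (hf : ∀ x, G.currentOut f x = (if x = a then 1 else 0) - (if x = b then 1 else 0))
    (z x : V) : G.voltage z x a - G.voltage z x b = f x - f z := by
  have h := G.eq_zero_of_currentOut z
    (fun x => (G.voltage z x a - G.voltage z x b) - (f x - f z))
    (by simp [(G.voltage_spec z _).1]) (fun x _ => by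
      rw [LengthGraph.currentOut_sub G.toLengthGraph
        (fun x => G.voltage z x a - G.voltage z x b) (fun x => f x - f z),
        currentOut_voltage_sub, LengthGraph.currentOut_sub_const, hf, sub_self])
  exact sub_eq_zero.mp (congrFun h x)

theorem resistance_eq (G : MetrizedGraph V E) (z x y : V) :
    G.resistance x y = G.voltage z x x + G.voltage z y y - 2 * G.voltage z x y := by
  have hx := G.voltage_sub_eq (G.voltage_spec y x).2 z x
  have hy := G.voltage_sub_eq (G.voltage_spec y x).2 z y
  have h0 := (G.voltage_spec y x).1
  have hs := G.voltage_symm z x y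
  simp only at h0 hx hy
  rw [resistance]
  linarith

theorem kirchhoffIndex_eq (G : MetrizedGraph V E) (z : V) :
    G.kirchhoffIndex = Fintype.card V * ∑ x, G.voltage z x x - ∑ x, ∑ y, G.voltage z x y := by
  simp only [kirchhoffIndex, G.resistance_eq z, Finset.sum_sub_distrib, Finset.sum_add_distrib,
    Finset.sum_const, Finset.card_univ, nsmul_eq_mul, ← Finset.mul_sum]
  ring

theorem resistance_eq_of_currentOut (G : MetrizedGraph V E) {a b : V} {f : V → ℝ}
    (hf : ∀ x, G.currentOut f x = (if x = a then 1 else 0) - (if x = b then 1 else 0)) :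
    G.resistance a b = f a - f b := by
  have h := G.voltage_sub_eq hf b a
  have h0 : G.voltage b b a = 0 := (G.voltage_spec b a).1
  rwa [G.voltage_symm b a b, h0, sub_zero] at h

/-- Add `voltage_sub_eq` at `a` and at `b`; the cross terms cancel by symmetry. -/
theorem voltage_self_sub_eq (G : MetrizedGraph V E) {a b : V} {f : V → ℝ}
    (hf : ∀ x, G.currentOut f x = (if x = a then 1 else 0) - (if x = b then 1 else 0)) (z : V) :
    G.voltage z a a - G.voltage z b b = f a + f b - 2 * f z := by
  have ha := G.voltage_sub_eq hf z a
  have hb := G.voltage_sub_eq hf z b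
  have hs := G.voltage_symm z a b
  linarith

/-! ### The terms of `y(Γ)` as voltages of `Γ` itself -/

theorem edgeR_nonneg (G : MetrizedGraph V E) [DecidableEq E] (e : E) (he : ¬ G.IsBridge e) :
    0 ≤ G.edgeR e he := by
  have hs := (G.delete e he).voltage_spec (G.tgt e) (G.src e)
  exact hs.1.symm.trans_le ((G.delete e he).ge_of_currentOut hs.2 _)

/-- Reversing the flow negates its potential up to a constant, fixed by the value `0` at `src e`. -/
theorem edgeRa_eq (G : MetrizedGraph V E) [DecidableEq E] (e : E) (he : ¬ G.IsBridge e) (p : V) :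
    G.edgeRa e he p = G.edgeR e he - G.edgeRb e he p := by
  have hs := (G.delete e he).voltage_spec (G.tgt e) (G.src e)
  refine (G.delete e he).voltage_eq_of_isVoltage
    (f := fun x => G.edgeR e he - (G.delete e he).voltage (G.tgt e) x (G.src e))
    ⟨sub_self _, fun x => ?_⟩ p
  rw [LengthGraph.currentOut_const_sub, hs.2, neg_sub]

/-- The potential of a unit flow in `Γ` between the ends of `e`, from that in `Γ - e`. -/
theorem currentOut_edgeRb (G : MetrizedGraph V E) [DecidableEq E] (e : E) (he : ¬ G.IsBridge e)
    (x : V) :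
    G.currentOut (fun y => G.len e / (G.len e + G.edgeR e he) * G.edgeRb e he y) x =
      (if x = G.src e then 1 else 0) - (if x = G.tgt e then 1 else 0) := by
  have hs := (G.delete e he).voltage_spec (G.tgt e) (G.src e)
  have h1 : (G.deleteEdge e).currentOut (fun y => G.edgeRb e he y) x =
      (if x = G.src e then 1 else 0) - (if x = G.tgt e then 1 else 0) := hs.2 x
  have h2 : G.edgeRb e he (G.tgt e) = 0 := hs.1
  have h3 : G.edgeRb e he (G.src e) = G.edgeR e he := rfl
  have hL := G.len_pos e
  have hR := G.edgeR_nonneg e he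
  have hne : G.len e + G.edgeR e he ≠ 0 := by positivity
  -- Restoring `e` adds a current `R / L` to the unit flow in `Γ - e`; the factor `L / (L + R)`
  -- normalizes the total `1 + R / L`.
  rw [LengthGraph.currentOut_const_mul, LengthGraph.currentOut_eq_deleteEdge _ e, h1, h2, h3]
  field_simp
  ring

/-- The step function is constant along every edge but `e`, where a drop of `len e` drives unit
current. -/
theorem currentOut_bridgeRb (G : MetrizedGraph V E) [DecidableEq E] {e : E} (he : G.IsBridge e)
    (x : V) :
    G.currentOut (fun y => G.bridgeRb e y (G.len e)) x =
      (if x = G.src e then 1 else 0) - (if x = G.tgt e then 1 else 0) := by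
  have h0 : ∀ e' : {e' : E // e' ≠ e}, G.bridgeRb e ((G.deleteEdge e).src e') (G.len e) =
      G.bridgeRb e ((G.deleteEdge e).tgt e') (G.len e) := by
    intro e'
    have hr : (G.deleteEdge e).skeleton.Reachable ((G.deleteEdge e).src e')
        ((G.deleteEdge e).tgt e') :=
      (G.deleteEdge e).reachable_src_tgt e'
    have hiff : (G.deleteEdge e).skeleton.Reachable (G.src e) ((G.deleteEdge e).src e') ↔
        (G.deleteEdge e).skeleton.Reachable (G.src e) ((G.deleteEdge e).tgt e') :=
      ⟨fun h => h.trans hr, fun h => h.trans hr.symm⟩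
    simp only [bridgeRb]
    split_ifs <;> tauto
  have h1 : (G.deleteEdge e).currentOut (fun y => G.bridgeRb e y (G.len e)) x = 0 :=
    (G.deleteEdge e).currentOut_eq_zero_of_edges_eq _ h0 x
  have h2 : G.bridgeRb e (G.tgt e) (G.len e) = 0 := if_neg (G.not_reachable_of_isBridge he)
  have h3 : G.bridgeRb e (G.src e) (G.len e) = G.len e := if_pos (SimpleGraph.Reachable.refl _)
  rw [LengthGraph.currentOut_eq_deleteEdge _ e, h1, h2, h3, zero_sub, neg_div,
    div_self (G.len_pos e).ne']
  ring

/-- Parallel law: `r(a, b) = L R / (L + R)`, or `L` for a bridge. -/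
theorem sqTerm_eq (G : MetrizedGraph V E) [DecidableEq E] (e : E) :
    G.sqTerm e = G.resistance (G.src e) (G.tgt e) ^ 2 / G.len e := by
  have hL := G.len_pos e
  by_cases he : G.IsBridge e
  · have h2 : G.bridgeRb e (G.tgt e) (G.len e) = 0 := if_neg (G.not_reachable_of_isBridge he)
    have h3 : G.bridgeRb e (G.src e) (G.len e) = G.len e := if_pos (SimpleGraph.Reachable.refl _)
    rw [G.sqTerm_of_isBridge e he, G.resistance_eq_of_currentOut (G.currentOut_bridgeRb he), h2, h3]
    field_simp
    ring
  · have h2 : G.edgeRb e he (G.tgt e) = 0 :=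
      ((G.delete e he).voltage_spec (G.tgt e) (G.src e)).1
    have h3 : G.edgeRb e he (G.src e) = G.edgeR e he := rfl
    have hR := G.edgeR_nonneg e he
    have hne : G.len e + G.edgeR e he ≠ 0 := by positivity
    rw [sqTerm, dif_neg he, G.resistance_eq_of_currentOut (G.currentOut_edgeRb e he), h2, h3]
    field_simp
    ring

/-- By `voltage_self_sub_eq` the difference is `L / (L + R) * (R - 2 R_b)`, and `R - R_b = R_a`. For
a bridge it is `L` or `-L`. -/
theorem diffTerm_eq (G : MetrizedGraph V E) [DecidableEq E] (e : E) (p : V) :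
    G.diffTerm e p =
      (G.voltage p (G.src e) (G.src e) - G.voltage p (G.tgt e) (G.tgt e)) ^ 2 / G.len e := by
  have hL := G.len_pos e
  by_cases he : G.IsBridge e
  · have h2 : G.bridgeRb e (G.tgt e) (G.len e) = 0 := if_neg (G.not_reachable_of_isBridge he)
    have h3 : G.bridgeRb e (G.src e) (G.len e) = G.len e := if_pos (SimpleGraph.Reachable.refl _)
    rw [G.diffTerm_of_isBridge e he, G.voltage_self_sub_eq (G.currentOut_bridgeRb he), h2, h3,
      bridgeRb]
    split_ifs <;> field_simp <;> ring
  · have h2 : G.edgeRb e he (G.tgt e) = 0 :=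
      ((G.delete e he).voltage_spec (G.tgt e) (G.src e)).1
    have h3 : G.edgeRb e he (G.src e) = G.edgeR e he := rfl
    have hR := G.edgeR_nonneg e he
    have hne : G.len e + G.edgeR e he ≠ 0 := by positivity
    rw [diffTerm, dif_neg he, G.voltage_self_sub_eq (G.currentOut_edgeRb e he), h2, h3, edgeRa_eq]
    field_simp
    ring

/-- Popoviciu's inequality for finite sums. -/
theorem _root_.card_mul_sum_sq_sub_sq_sum_le {ι : Type*} [Fintype ι] (h : ι → ℝ) {m M : ℝ}
    (hm : ∀ x, m ≤ h x) (hM : ∀ x, h x ≤ M) :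
    Fintype.card ι * ∑ x, h x ^ 2 - (∑ x, h x) ^ 2 ≤ (Fintype.card ι : ℝ) ^ 2 / 4 * (M - m) ^ 2 := by
  have h1 : 0 ≤ ∑ x, (M - h x) * (h x - m) :=
    Finset.sum_nonneg fun x _ => mul_nonneg (sub_nonneg.mpr (hM x)) (sub_nonneg.mpr (hm x))
  have h2 : ∑ x, (M - h x) * (h x - m) =
      (M + m) * ∑ x, h x - ∑ x, h x ^ 2 - Fintype.card ι * (M * m) := by
    rw [Finset.mul_sum, ← Finset.sum_sub_distrib, ← nsmul_eq_mul, ← Finset.card_univ,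
      ← Finset.sum_const, ← Finset.sum_sub_distrib]
    exact Finset.sum_congr rfl fun x _ => by ring
  rw [h2] at h1
  have h3 := mul_nonneg (Nat.cast_nonneg (α := ℝ) (Fintype.card ι)) h1
  -- With `S = ∑ h` and `n` the cardinality, `n (M + m) S - n ^ 2 M m - S ^ 2` equals `n ^ 2 (M - m)
  -- ^ 2 / 4` minus this square.
  nlinarith [sq_nonneg (∑ x, h x - Fintype.card ι * (M + m) / 2)]

/-! ### The two bounds for the Kirchhoff index -/

theorem kirchhoffIndex_eq_sum_edges (G : MetrizedGraph V E) (z : V) :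
    G.kirchhoffIndex = ∑ e,
      (Fintype.card V * ∑ x, (G.voltage z x (G.src e) - G.voltage z x (G.tgt e)) ^ 2 -
        (∑ x, (G.voltage z x (G.src e) - G.voltage z x (G.tgt e))) ^ 2) / G.len e := by
  -- The Gram representation of `J`: the energy of `j_z(·, x)` against `j_z(·, y)`, with arguments
  -- swapped by symmetry.
  have hE : ∀ x y, G.voltage z x y = ∑ e,
      (G.voltage z x (G.src e) - G.voltage z x (G.tgt e)) *
        (G.voltage z y (G.src e) - G.voltage z y (G.tgt e)) / G.len e := by
    intro x y
    have h := G.energy_voltage z y (fun w => G.voltage z w x)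
    simp only [(G.voltage_spec z _).1, sub_zero] at h
    rw [G.voltage_symm z x y, ← h, LengthGraph.energy]
    simp only [G.voltage_symm z x, G.voltage_symm z y]
  rw [G.kirchhoffIndex_eq z]
  have h1 : ∑ x, G.voltage z x x =
      ∑ e, (∑ x, (G.voltage z x (G.src e) - G.voltage z x (G.tgt e)) ^ 2) / G.len e := by
    rw [Finset.sum_congr rfl fun x _ => hE x x, Finset.sum_comm]
    simp only [Finset.sum_div, sq]
  have h2 : ∑ x, ∑ y, G.voltage z x y =
      ∑ e, (∑ x, (G.voltage z x (G.src e) - G.voltage z x (G.tgt e))) ^ 2 / G.len e := by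
    rw [Finset.sum_congr rfl fun x _ => Finset.sum_congr rfl fun y _ => hE x y]
    rw [Finset.sum_congr rfl fun x _ => Finset.sum_comm, Finset.sum_comm]
    simp only [sq, Finset.sum_mul_sum, Finset.sum_div]
  rw [h1, h2, Finset.mul_sum, ← Finset.sum_sub_distrib]
  exact Finset.sum_congr rfl fun e _ => by ring

theorem kirchhoffIndex_le_sum_sqTerm (G : MetrizedGraph V E) [DecidableEq E] :
    G.kirchhoffIndex ≤ (Fintype.card V : ℝ) ^ 2 / 4 * ∑ e, G.sqTerm e := by
  obtain ⟨z⟩ := G.connected.nonempty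
  rw [G.kirchhoffIndex_eq_sum_edges z, Finset.mul_sum]
  refine Finset.sum_le_sum fun e _ => ?_
  have hc := G.currentOut_voltage_sub z (G.src e) (G.tgt e)
  rw [sqTerm_eq, ← mul_div_assoc, G.resistance_eq_of_currentOut hc]
  exact div_le_div_of_nonneg_right
    (card_mul_sum_sq_sub_sq_sum_le _ (G.ge_of_currentOut hc) (G.le_of_currentOut hc))
    (G.len_pos e).le

theorem kirchhoffIndex_le_sum_diffTerm (G : MetrizedGraph V E) [DecidableEq E] (p : V) :
    G.kirchhoffIndex ≤ (Fintype.card V : ℝ) ^ 2 / 4 * ∑ e, G.diffTerm e p := by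
  set d : V → ℝ := fun x => G.voltage p x x with hd
  set u : V → ℝ := fun x => ∑ y, G.voltage p x y with hu
  set v : ℝ := (Fintype.card V : ℝ)
  -- The reproducing property summed over all sources `y`: pairing with `u` sums the values.
  have hfu : ∀ f : V → ℝ, f p = 0 → G.energy f u = ∑ y, f y := by
    intro f hf
    have h : G.energy f u = ∑ y, G.energy f (fun x => G.voltage p x y) := by
      simp only [LengthGraph.energy, hu]
      rw [Finset.sum_comm]
      refine Finset.sum_congr rfl fun e _ => ?_
      rw [← Finset.sum_sub_distrib, Finset.mul_sum, Finset.sum_div]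
    simp only [h, energy_voltage, hf, sub_zero]
  have hdp : d p = 0 := (G.voltage_spec p p).1
  have hup : u p = 0 := Finset.sum_eq_zero fun y _ => (G.voltage_spec p y).1
  -- Since `E(d, u) = ∑ d = tr J` and `E(u, u) = ∑ u = ∑ J`, the coefficients `v` and `-2` make the
  -- last two terms add up to `-4 Kf`.
  have hexp : G.energy (fun x => v * d x - 2 * u x) (fun x => v * d x - 2 * u x) =
      v ^ 2 * G.energy d d - 4 * v * G.energy d u + 4 * G.energy u u := by
    simp only [LengthGraph.energy, Finset.mul_sum, ← Finset.sum_sub_distrib,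
      ← Finset.sum_add_distrib]
    exact Finset.sum_congr rfl fun e _ => by ring
  have hnn := G.energy_self_nonneg (fun x => v * d x - 2 * u x)
  have hdd : ∑ e, G.diffTerm e p = G.energy d d := by
    simp only [diffTerm_eq, LengthGraph.energy, hd, sq]
  rw [hexp, hfu d hdp, hfu u hup] at hnn
  rw [G.kirchhoffIndex_eq p, hdd]
  linarith

end MetrizedGraph

theorem mainTheorem6 {V E : Type*} [Fintype V] [Fintype E] [DecidableEq V] [DecidableEq E]
    (G : MetrizedGraph V E) (p : V) :
    G.kirchhoffIndex ≤ (Fintype.card V : ℝ) ^ 2 / 4 * G.yInv p := by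
  have h1 := G.kirchhoffIndex_le_sum_sqTerm
  have h2 := G.kirchhoffIndex_le_sum_diffTerm p
  rw [MetrizedGraph.yInv]
  linarith
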